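/- Let $H$ be a separable real Hilbert space with a fixed orthonormal basis $(e_i)$, let $(\Omega,\mathsf P)$ be a standard probability space, and let $(\mathcal T,\mu)$ be a standard measurable space with a $\sigma$-finite measure. A generalized $H$-valued function on $(\mathcal T,\mu)$ is a continuous linear operator $Y:\xi\mapsto\langle Y,\xi\rangle$ from $H$ to $L^0(\mathcal T,\mu)$, the space of $\mu$-classes of measurable functions with the topology of convergence in measure with respect to a probability measure equivalent to $\mu$ (and $L^0=\{0\}$ if $\mu=0$); its value $Y(t)$ is identified with the sequence $(\langle Y,e_i\rangle(t))_i$, defined for almost all $t$. Let $X$ be a standard Gaussian vector in $H$, that is, a generalized $H$-valued function on $(\Omega,\mathsf P)$ such that each $\langle X,\xi\rangle$ is a centred Gaussian variable of variance $\|\xi\|^2$. Let $Y$ be a generalized $H$-valued function on $(\mathcal T,\mu)$. A Gaussian multiplicative chaos (GMC) associated to $Y$ is a random measure $M$ on $\mathcal T$, positive and almost surely finite, such that (i) $\mathsf E M\ll\mu$; (ii) $M$ is measurable with respect to $X$, so that $M=M(X)$ almost surely; (iii) for each $\xi\in H$, almost surely $M(X+\xi,dt)=e^{\langle Y(t),\xi\rangle}M(X,dt)$.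 It is subcritical if $\mathsf E M$ is $\sigma$-finite. Suppose that $M$ is a subcritical GMC associated to $Y$ with $\mathsf E M=\mu$. Then: 1. $M$ is unique as a function of $X$: if $M'$ is another subcritical GMC associated to $Y$ with $\mathsf E M'=\mu$, then $M'=M$ almost surely. 2. $\mathrm{Law}_{\mathsf P\otimes\mu}[X+Y(t)]$ is absolutely continuous with respect to $\mathrm{Law}\,X$, and almost surely $$M[\mathcal T]=\frac{d\,\mathrm{Law}_{\mathsf P\otimes\mu}[X+Y(t)]}{d\,\mathrm{Law}\,X}(X).$$ 3. The normalized measure is the conditional law of $t$ given $X+Y(t)$: for every measurable version $x\mapsto M(x,\cdot)$ of $M$ as a function of $X$, $$M(x,\mathcal T)^{-1}M(x,dt)=\mathrm{Law}_{\mathsf P\otimes\mu}\bigl[t\in dt\mid X+Y(t)=x\bigr]$$ for $\mathrm{Law}_{\mathsf P\otimes\mu}[X+Y(t)]$-almost all $x$. That is, the left-hand side is a regular conditional law of $t$ given $X+Y(t)$ under $\mathsf P\otimes\mu$, and every such regular conditional law agrees with it for almost all $x$. -/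

import Mathlib

open MeasureTheory ProbabilityTheory Filter Topology

namespace GMC

/-- A generalized `H`-valued function on `(S, ν)`: a continuous linear operator from `H` to the space
`L⁰(S, ν)` of classes of measurable functions with the topology of convergence in measure. For a
sigma-finite `ν` this is the topology of convergence in measure with respect to any probability
measure equivalent to `ν`; for `ν = 0` the space `L⁰` is trivial. On a probability space, this is a
generalized random vector in `H`. -/
structure GeneralizedFunction (H : Type*) [NormedAddCommGroup H] [InnerProductSpace ℝ H]
    {S : Type*} [MeasurableSpace S] (ν : Measure S) extends H →ₗ[ℝ] (S →ₘ[ν] ℝ) where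
  continuous_inMeasure : ∀ ν' : Measure S, IsProbabilityMeasure ν' → ν' ≪ ν → ν ≪ ν' →
    ∀ ξ₀ : H, TendstoInMeasure ν' (fun ξ : H => (toFun ξ : S → ℝ)) (𝓝 ξ₀) (toFun ξ₀ : S → ℝ)

section

variable {H : Type*} [NormedAddCommGroup H] [InnerProductSpace ℝ H]

/-- The function `t ↦ ⟨Y(t), ξ⟩` (a measurable representative of its class). -/
noncomputable def GeneralizedFunction.pairing {S : Type*} [MeasurableSpace S] {ν : Measure S}
    (Y : GeneralizedFunction H ν) (ξ : H) : S → ℝ :=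
  (Y.toLinearMap ξ : S → ℝ)

/-- `X` is standard Gaussian in `H`: each `⟨X, ξ⟩` is centred Gaussian of variance `‖ξ‖²`. -/
def IsStandardGaussian {Ω : Type*} [MeasurableSpace Ω] {P : Measure Ω}
    (X : GeneralizedFunction H P) : Prop :=
  ∀ ξ : H, P.map (X.pairing ξ) = gaussianReal 0 (‖ξ‖₊ ^ 2)

variable {ι : Type*} (e : HilbertBasis ι ℝ H)

/-- The "value" `Y(t)`, identified with its coordinates in the fixed orthonormal basis `e`. -/
noncomputable def GeneralizedFunction.value {S : Type*} [MeasurableSpace S] {ν : Measure S}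
    (Y : GeneralizedFunction H ν) (t : S) : ι → ℝ :=
  fun i => Y.pairing (e i) t

/-- The coordinates of a true vector `ξ` of `H` in the basis `e`. -/
noncomputable def coords (ξ : H) : ι → ℝ :=
  fun i => inner ℝ (e i) ξ

/-- The expectation `E M` of a random measure: `(E M)(A) = E (M(A))`. -/
noncomputable def expectation {Ω T : Type*} [MeasurableSpace Ω] [MeasurableSpace T]
    (P : Measure Ω) (M : Ω → Measure T) : Measure T :=
  P.bind M

/-- A random measure on `(T, μ)`: a random positive finite measure `M` with `E M ≪ μ`. -/
structure IsRandomMeasure {Ω T : Type*} [MeasurableSpace Ω] [MeasurableSpace T]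
    (P : Measure Ω) (μ : Measure T) (M : Ω → Measure T) : Prop where
  aemeasurable : AEMeasurable M P
  finite : ∀ᵐ ω ∂P, IsFiniteMeasure (M ω)
  expectation_ac : expectation P M ≪ μ

/-- `m` represents `M` as a measurable function of `X`, that is, `M = m(X)` almost surely. -/
structure IsFunctionalOf {Ω T : Type*} [MeasurableSpace Ω] [MeasurableSpace T] {P : Measure Ω}
    (X : GeneralizedFunction H P) (M : Ω → Measure T) (m : (ι → ℝ) → Measure T) : Prop where
  measurable : Measurable m
  eq : ∀ᵐ ω ∂P, M ω = m (X.value e ω)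

/-- `M` is a Gaussian multiplicative chaos over `(X, Y)`: it is a random measure on `(T, μ)`, it is
measurable with respect to `X`, say `M = m(X)`, and for each `ξ` in `H`, almost surely
`m(X + ξ, dt) = exp ⟨Y(t), ξ⟩ m(X, dt)`. -/
structure IsGMC {Ω T : Type*} [MeasurableSpace Ω] [MeasurableSpace T] {P : Measure Ω}
    {μ : Measure T} (X : GeneralizedFunction H P) (Y : GeneralizedFunction H μ)
    (M : Ω → Measure T) : Prop where
  isRandomMeasure : IsRandomMeasure P μ M
  shift : ∃ m : (ι → ℝ) → Measure T, IsFunctionalOf e X M m ∧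
    ∀ ξ : H, ∀ᵐ ω ∂P, m (X.value e ω + coords e ξ) =
      (m (X.value e ω)).withDensity (fun t => ENNReal.ofReal (Real.exp (Y.pairing ξ t)))

/-- A GMC is subcritical if its expectation is sigma-finite. -/
structure IsSubcriticalGMC {Ω T : Type*} [MeasurableSpace Ω] [MeasurableSpace T] {P : Measure Ω}
    {μ : Measure T} (X : GeneralizedFunction H P) (Y : GeneralizedFunction H μ)
    (M : Ω → Measure T) : Prop where
  isGMC : IsGMC e X Y M
  sigmaFinite : SigmaFinite (expectation P M)

/-- The law of a generalized random vector, as a measure on the space of coordinate sequences. -/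
noncomputable def law {Ω : Type*} [MeasurableSpace Ω] {P : Measure Ω}
    (X : GeneralizedFunction H P) : Measure (ι → ℝ) :=
  P.map (X.value e)

/-- The generalized vector `X + Y(t)` on the product space, where `t` is sampled independently
of `X`. -/
noncomputable def shifted {Ω T : Type*} [MeasurableSpace Ω] [MeasurableSpace T] {P : Measure Ω}
    {μ : Measure T} (X : GeneralizedFunction H P) (Y : GeneralizedFunction H μ) (p : Ω × T) :
    ι → ℝ :=
  X.value e p.1 + Y.value e p.2

/-- The law of `X + Y(t)` under `P ⊗ μ`. -/
noncomputable def lawShifted {Ω T : Type*} [MeasurableSpace Ω] [MeasurableSpace T] {P : Measure Ω}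
    {μ : Measure T} (X : GeneralizedFunction H P) (Y : GeneralizedFunction H μ) :
    Measure (ι → ℝ) :=
  (P.prod μ).map (shifted e X Y)

end

/-- `κ` is a regular conditional law of `V` given `U` under `ρ`: the measures `κ x` depend
measurably on `x`, they are probability measures for almost all `x` with respect to the law of `U`,
and they disintegrate the joint law of `(U, V)` over the law of `U`. Here `ρ` need not be finite
(Mathlib's `condDistrib` is restricted to finite measures). -/
structure IsCondLaw {S E T : Type*} [MeasurableSpace S] [MeasurableSpace E] [MeasurableSpace T]
    (ρ : Measure S) (V : S → T) (U : S → E) (κ : E → Measure T) : Prop where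
  measurable : Measurable κ
  isProbabilityMeasure : ∀ᵐ x ∂(ρ.map U), IsProbabilityMeasure (κ x)
  disintegrate : ∀ B : Set E, MeasurableSet B → ∀ A : Set T, MeasurableSet A →
    ρ (U ⁻¹' B ∩ V ⁻¹' A) = ∫⁻ x in B, κ x A ∂(ρ.map U)

end GMC

/-!
Everything follows from a randomized Cameron–Martin formula on rectangles: for measurable `B` and
`A`, and any version `m` of `M` as a function of `X`,
`∫ x in B, m(x, A) d(Law X) = (P ⊗ μ) (X + Y(t) ∈ B, t ∈ A)`.
In words, sampling `t` from the chaos amounts to shifting `X` by `Y(t)`.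

To prove it for the version `m` that satisfies the shift covariance, fix a finite set `F` of
coordinates and a set `A` of finite measure on which `Y_i`, `i ∈ F`, are bounded, and compare
Laplace transforms in the direction `ξ = ∑ i ∈ F, c i • e i`. By Cameron–Martin and the shift
covariance,
`E [exp ⟨X, ξ⟩ m(X, A)] = exp (‖ξ‖² / 2) E [m(X + ξ, A)] = exp (‖ξ‖² / 2) ∫_A exp ⟨Y(t), ξ⟩ dμ`,
since `E M = μ`; the right-hand side is the transform of `X + Y(t)` on `A` by independence
(`IsChaosVersion.lintegral_exp_mul`, `IsStandardGaussian.lintegral_exp_shifted`). Finite Laplace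
transforms determine finite-dimensional laws (`map_restrict_eq_of_lintegral_exp_eq`), which gives
the formula for cylinders `B` and such `A`. For fixed `B` both sides are measures in `A`, so the
bound on `A` is removed by a countable cover; for fixed `A` of finite measure both sides are finite
measures in `B`, so cylinders suffice (`IsChaosVersion.setLIntegral_law`). The Cameron–Martin
formula itself is obtained by comparing Laplace transforms too
(`IsStandardGaussian.map_value_add_coords`).

The right-hand side of the formula does not involve `M`, so that `m(·, A)` is determined almost
everywhere for each `A`, and hence so is `m`. Taking `A` to be the whole space identifies `m(·, T)`
as the density of the law of `X + Y(t)`, and dividing by it turns the formula into the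
disintegration that defines the conditional law of `t`.
-/

open MeasureTheory ProbabilityTheory Filter Topology

namespace GMC

open scoped ENNReal

/-! ### Laplace transforms determine finite measures -/

/-- By analytic continuation, a finite moment generating function determines the characteristic
function, and with it the law. -/
lemma map_eq_of_lintegral_exp_eq {E : Type*} [MeasurableSpace E] {ρ ρ' : Measure E}
    [IsFiniteMeasure ρ] [IsFiniteMeasure ρ'] {f : E → ℝ} (hf : Measurable f)
    (hfin : ∀ s : ℝ, ∫⁻ x, ENNReal.ofReal (Real.exp (s * f x)) ∂ρ ≠ ∞)
    (h : ∀ s : ℝ, ∫⁻ x, ENNReal.ofReal (Real.exp (s * f x)) ∂ρ =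
      ∫⁻ x, ENNReal.ofReal (Real.exp (s * f x)) ∂ρ') :
    ρ.map f = ρ'.map f := by
  have hmgf : mgf f ρ = mgf f ρ' := by
    funext s
    rw [mgf, mgf, integral_eq_lintegral_of_nonneg_ae (ae_of_all _ fun _ => (Real.exp_pos _).le)
      (by fun_prop), integral_eq_lintegral_of_nonneg_ae
      (ae_of_all _ fun _ => (Real.exp_pos _).le) (by fun_prop), h s]
  have hzero : ρ = 0 ↔ ρ' = 0 := by
    have h0 := h 0
    simp only [zero_mul, Real.exp_zero, ENNReal.ofReal_one, lintegral_const, one_mul] at h0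
    rw [← Measure.measure_univ_eq_zero, ← Measure.measure_univ_eq_zero, h0]
  have hset : integrableExpSet f ρ = Set.univ := by
    refine Set.eq_univ_of_forall fun s => ⟨by fun_prop, ?_⟩
    rw [hasFiniteIntegral_iff_ofReal (ae_of_all _ fun _ => (Real.exp_pos _).le)]
    exact (hfin s).lt_top
  refine Measure.ext_of_complexMGF_eq hf.aemeasurable hf.aemeasurable (funext fun z => ?_)
  exact eqOn_complexMGF_of_mgf' hmgf hzero (by simp [hset])

/-- Finite-dimensional marginals are determined by their Laplace transforms, provided that these
are finite: the one-dimensional case gives the laws of all linear forms, hence the characteristic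
function. -/
lemma map_restrict_eq_of_lintegral_exp_eq {ι : Type*} {ρ ρ' : Measure (ι → ℝ)}
    [IsFiniteMeasure ρ] [IsFiniteMeasure ρ'] (F : Finset ι)
    (hfin : ∀ c : F → ℝ, ∫⁻ x, ENNReal.ofReal (Real.exp (∑ i : F, c i * x i)) ∂ρ ≠ ∞)
    (h : ∀ c : F → ℝ, ∫⁻ x, ENNReal.ofReal (Real.exp (∑ i : F, c i * x i)) ∂ρ =
      ∫⁻ x, ENNReal.ofReal (Real.exp (∑ i : F, c i * x i)) ∂ρ') :
    ρ.map F.restrict = ρ'.map F.restrict := by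
  classical
  refine Measure.ext_of_charFunDual (funext fun L => ?_)
  have hL : ∀ x : ι → ℝ, L (F.restrict x) = ∑ i : F, L (Pi.single i 1) * x i := by
    intro x
    conv_lhs => rw [← Finset.univ_sum_single (F.restrict x)]
    rw [map_sum]
    refine Finset.sum_congr rfl fun i _ => ?_
    have : (Pi.single i (F.restrict x i) : F → ℝ) = x i • Pi.single i 1 := by
      rw [← Pi.single_smul]; simp
    rw [this, map_smul, smul_eq_mul, mul_comm]
  have hmul : ∀ (s : ℝ) (x : ι → ℝ),
      s * L (F.restrict x) = ∑ i : F, (s * L (Pi.single i 1)) * x i := by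
    intro s x
    rw [hL, Finset.mul_sum]
    simp_rw [mul_assoc]
  have hmeas : Measurable fun x : ι → ℝ => L (F.restrict x) :=
    L.continuous.measurable.comp (Finset.measurable_restrict F)
  rw [charFunDual_eq_charFun_map_one, charFunDual_eq_charFun_map_one,
    Measure.map_map L.continuous.measurable (Finset.measurable_restrict F),
    Measure.map_map L.continuous.measurable (Finset.measurable_restrict F)]
  congr 1
  refine map_eq_of_lintegral_exp_eq hmeas (fun s => ?_) fun s => ?_
  · simp only [Function.comp_apply, hmul]
    exact hfin _
  · simp only [Function.comp_apply, hmul]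
    exact h _

lemma ext_of_map_restrict {ι : Type*} {ρ ρ' : Measure (ι → ℝ)} [IsFiniteMeasure ρ]
    (h : ∀ F : Finset ι, ρ.map F.restrict = ρ'.map F.restrict) : ρ = ρ' := by
  have : IsProjectiveLimit ρ (fun F : Finset ι => ρ.map F.restrict) := fun F => rfl
  have h' : IsProjectiveLimit ρ' (fun F : Finset ι => ρ.map F.restrict) := fun F => (h F).symm
  exact this.unique h'

/-! ### Random measures and countable generation -/

/-- Almost everywhere equality of random finite measures may be tested on one set at a time, as
the σ-algebra is countably generated. -/
lemma ae_eq_of_forall_measure_ae_eq {E T : Type*} [MeasurableSpace E] [MeasurableSpace T]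
    [MeasurableSpace.CountablyGenerated T] {ρ : Measure E} {κ κ' : E → Measure T}
    (hfin : ∀ᵐ x ∂ρ, IsFiniteMeasure (κ x))
    (h : ∀ A, MeasurableSet A → ∀ᵐ x ∂ρ, κ x A = κ' x A) : ∀ᵐ x ∂ρ, κ x = κ' x := by
  obtain ⟨S, hS, hgen⟩ := MeasurableSpace.CountablyGenerated.isCountablyGenerated (α := T)
  have halg := isSetAlgebra_generateSetAlgebra (𝒜 := S)
  have hmeas : ∀ A ∈ generateSetAlgebra S, MeasurableSet A := fun A hA => by
    rw [hgen, ← generateFrom_generateSetAlgebra_eq]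
    exact MeasurableSpace.measurableSet_generateFrom hA
  have hae : ∀ᵐ x ∂ρ, ∀ A ∈ generateSetAlgebra S, κ x A = κ' x A :=
    (ae_ball_iff (countable_generateSetAlgebra hS)).2 fun A hA => h A (hmeas A hA)
  filter_upwards [hfin, hae] with x hx hA
  exact ext_of_generate_finite _ (hgen.trans generateFrom_generateSetAlgebra_eq.symm)
    (fun A hA B hB _ => halg.inter_mem hA hB) hA (hA _ halg.univ_mem)

/-! ### Linear forms in a Gaussian vector and the Cameron–Martin formula -/

section

variable {H : Type*} [NormedAddCommGroup H] [InnerProductSpace ℝ H] {ι : Type*}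
  (e : HilbertBasis ι ℝ H)

lemma GeneralizedFunction.measurable_pairing {S : Type*} [MeasurableSpace S] {ν : Measure S}
    (Y : GeneralizedFunction H ν) (ξ : H) : Measurable (Y.pairing ξ) :=
  AEEqFun.measurable _

lemma GeneralizedFunction.measurable_value {S : Type*} [MeasurableSpace S] {ν : Measure S}
    (Y : GeneralizedFunction H ν) : Measurable (Y.value e) :=
  measurable_pi_lambda _ fun i => Y.measurable_pairing (e i)

lemma GeneralizedFunction.pairing_add {S : Type*} [MeasurableSpace S] {ν : Measure S}
    (Y : GeneralizedFunction H ν) (ξ η : H) :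
    Y.pairing (ξ + η) =ᵐ[ν] Y.pairing ξ + Y.pairing η := by
  unfold pairing
  rw [map_add]
  exact AEEqFun.coeFn_add _ _

lemma GeneralizedFunction.pairing_sum {S : Type*} [MeasurableSpace S] {ν : Measure S}
    (Y : GeneralizedFunction H ν) (F : Finset ι) (c : F → ℝ) :
    Y.pairing (∑ i : F, c i • e i) =ᵐ[ν] fun t => ∑ i : F, c i * Y.value e t i := by
  have key : ∀ s : Finset F, Y.pairing (∑ i ∈ s, c i • e i) =ᵐ[ν]
      fun t => ∑ i ∈ s, c i * Y.value e t i := by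
    classical
    intro s
    induction s using Finset.induction_on with
    | empty =>
      simp only [Finset.sum_empty, pairing, map_zero]
      exact AEEqFun.coeFn_zero
    | insert i s hi ih =>
      simp only [Finset.sum_insert hi]
      have h2 : Y.pairing (c i • e i) =ᵐ[ν] fun t => c i * Y.value e t i := by
        unfold pairing
        rw [map_smul]
        exact AEEqFun.coeFn_smul _ _
      filter_upwards [Y.pairing_add (c i • e i) (∑ i ∈ s, c i • e i), ih, h2] with t h3 h4 h5
      rw [h3, Pi.add_apply, h4, h5]
  exact key Finset.univ

lemma sum_mul_coords (F : Finset ι) (c : F → ℝ) (ξ : H) :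
    ∑ i : F, c i * coords e ξ i = inner ℝ (∑ i : F, c i • e i) ξ := by
  simp [sum_inner, inner_smul_left, coords]

lemma IsStandardGaussian.lintegral_exp_pairing {Ω : Type*} [MeasurableSpace Ω] {P : Measure Ω}
    {X : GeneralizedFunction H P} (hX : IsStandardGaussian X) (ξ : H) :
    ∫⁻ ω, ENNReal.ofReal (Real.exp (X.pairing ξ ω)) ∂P =
      ENNReal.ofReal (Real.exp (‖ξ‖ ^ 2 / 2)) := by
  have hmap : ∫⁻ ω, ENNReal.ofReal (Real.exp (X.pairing ξ ω)) ∂P =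
      ∫⁻ y, ENNReal.ofReal (Real.exp y) ∂(gaussianReal 0 (‖ξ‖₊ ^ 2)) := by
    rw [← hX ξ, lintegral_map (by fun_prop) (X.measurable_pairing ξ)]
  have hint := integrable_exp_mul_gaussianReal (μ := 0) (v := ‖ξ‖₊ ^ 2) 1
  have hval := congrFun (mgf_id_gaussianReal (μ := 0) (v := ‖ξ‖₊ ^ 2)) 1
  simp only [one_mul] at hint
  simp only [mgf, id, one_mul, zero_add, one_pow, mul_one, NNReal.coe_pow,
    coe_nnnorm] at hval
  rw [hmap, ← ofReal_integral_eq_lintegral_ofReal hint (ae_of_all _ fun _ => (Real.exp_pos _).le),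
    hval]

lemma IsStandardGaussian.lintegral_exp_value {Ω : Type*} [MeasurableSpace Ω] {P : Measure Ω}
    {X : GeneralizedFunction H P} (hX : IsStandardGaussian X) (F : Finset ι) (c : F → ℝ) :
    ∫⁻ ω, ENNReal.ofReal (Real.exp (∑ i : F, c i * X.value e ω i)) ∂P =
      ENNReal.ofReal (Real.exp (‖∑ i : F, c i • e i‖ ^ 2 / 2)) := by
  rw [← hX.lintegral_exp_pairing]
  refine lintegral_congr_ae ?_
  filter_upwards [X.pairing_sum e F c] with ω hω
  rw [hω]

/-- Cameron–Martin: translating `X` by `ξ` amounts to tilting the probability by the density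
`exp (⟨X, ξ⟩ - ‖ξ‖² / 2)`. Both laws have the same Laplace transforms. -/
lemma IsStandardGaussian.map_value_add_coords {Ω : Type*} [MeasurableSpace Ω] {P : Measure Ω}
    [IsProbabilityMeasure P] {X : GeneralizedFunction H P} (hX : IsStandardGaussian X) (ξ : H) :
    P.map (fun ω => X.value e ω + coords e ξ) =
      (P.withDensity fun ω =>
        ENNReal.ofReal (Real.exp (X.pairing ξ ω - ‖ξ‖ ^ 2 / 2))).map (X.value e) := by
  have hXm := X.measurable_value e
  have hXp := X.measurable_pairing ξ
  have htilt : ∀ (c : ℝ) (g : Ω → ℝ), ∫⁻ ω, ENNReal.ofReal (Real.exp (g ω + c)) ∂P =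
      ENNReal.ofReal (Real.exp c) * ∫⁻ ω, ENNReal.ofReal (Real.exp (g ω)) ∂P := by
    intro c g
    rw [← lintegral_const_mul' _ _ ENNReal.ofReal_ne_top]
    refine lintegral_congr fun ω => ?_
    rw [← ENNReal.ofReal_mul (Real.exp_pos _).le, ← Real.exp_add, add_comm]
  have hfinite : IsFiniteMeasure (P.withDensity fun ω =>
      ENNReal.ofReal (Real.exp (X.pairing ξ ω - ‖ξ‖ ^ 2 / 2))) := by
    refine isFiniteMeasure_withDensity ?_
    simp_rw [sub_eq_add_neg]
    rw [htilt, hX.lintegral_exp_pairing]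
    exact ENNReal.mul_ne_top ENNReal.ofReal_ne_top ENNReal.ofReal_ne_top
  have hleft : ∀ (F : Finset ι) (c : F → ℝ),
      ∫⁻ x, ENNReal.ofReal (Real.exp (∑ i : F, c i * x i))
        ∂(P.map fun ω => X.value e ω + coords e ξ) =
      ENNReal.ofReal (Real.exp (inner ℝ (∑ i : F, c i • e i) ξ)) *
        ENNReal.ofReal (Real.exp (‖∑ i : F, c i • e i‖ ^ 2 / 2)) := by
    intro F c
    rw [lintegral_map (by fun_prop) (by fun_prop), ← hX.lintegral_exp_value e, ← htilt]
    refine lintegral_congr fun ω => ?_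
    rw [← sum_mul_coords, ← Finset.sum_add_distrib]
    simp only [Pi.add_apply, mul_add]
  refine ext_of_map_restrict fun F => map_restrict_eq_of_lintegral_exp_eq F (fun c => ?_)
    fun c => ?_
  · rw [hleft]
    exact ENNReal.mul_ne_top ENNReal.ofReal_ne_top ENNReal.ofReal_ne_top
  · rw [hleft, lintegral_map (by fun_prop) hXm,
      lintegral_withDensity_eq_lintegral_mul _ (by fun_prop) (by fun_prop)]
    have hcongr : ∫⁻ ω, ((fun ω => ENNReal.ofReal (Real.exp (X.pairing ξ ω - ‖ξ‖ ^ 2 / 2))) *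
        fun ω => ENNReal.ofReal (Real.exp (∑ i : F, c i * X.value e ω i))) ω ∂P =
        ∫⁻ ω, ENNReal.ofReal (Real.exp (X.pairing ((∑ i : F, c i • e i) + ξ) ω +
          -(‖ξ‖ ^ 2 / 2))) ∂P := by
      refine lintegral_congr_ae ?_
      filter_upwards [X.pairing_sum e F c, X.pairing_add (∑ i : F, c i • e i) ξ] with ω h1 h2
      rw [h2, Pi.mul_apply, Pi.add_apply, h1, ← ENNReal.ofReal_mul (Real.exp_pos _).le,
        ← Real.exp_add]
      ring_nf
    rw [hcongr, htilt, hX.lintegral_exp_pairing, ← ENNReal.ofReal_mul (Real.exp_pos _).le,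
      ← ENNReal.ofReal_mul (Real.exp_pos _).le, ← Real.exp_add, ← Real.exp_add,
      norm_add_sq_real]
    ring_nf

end

/-! ### The randomized Cameron–Martin formula -/

section

variable {H : Type*} [NormedAddCommGroup H] [InnerProductSpace ℝ H] {ι : Type*}
  (e : HilbertBasis ι ℝ H)

/-- `m` is a measurable function of the coordinates of `X` whose mean under the law of `X` is `μ`
and which has the defining shift covariance of a chaos. -/
structure IsChaosVersion {Ω T : Type*} [MeasurableSpace Ω] [MeasurableSpace T] {P : Measure Ω}
    {μ : Measure T} (X : GeneralizedFunction H P) (Y : GeneralizedFunction H μ)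
    (m : (ι → ℝ) → Measure T) : Prop where
  measurable : Measurable m
  mean : P.bind (fun ω => m (X.value e ω)) = μ
  shift : ∀ ξ : H, ∀ᵐ ω ∂P, m (X.value e ω + coords e ξ) =
    (m (X.value e ω)).withDensity (fun t => ENNReal.ofReal (Real.exp (Y.pairing ξ t)))

variable {Ω T : Type*} [MeasurableSpace Ω] [MeasurableSpace T] {P : Measure Ω}
  {μ : Measure T} {X : GeneralizedFunction H P} {Y : GeneralizedFunction H μ}
  {m : (ι → ℝ) → Measure T}

lemma IsChaosVersion.measurable_apply (hm : IsChaosVersion e X Y m) {A : Set T}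
    (hA : MeasurableSet A) : Measurable fun x => m x A :=
  (Measure.measurable_coe hA).comp hm.measurable

lemma IsChaosVersion.lintegral_apply (hm : IsChaosVersion e X Y m) {A : Set T}
    (hA : MeasurableSet A) : ∫⁻ ω, m (X.value e ω) A ∂P = μ A := by
  rw [← Measure.bind_apply hA (f := fun ω => m (X.value e ω))
    (hm.measurable.comp (X.measurable_value e)).aemeasurable, hm.mean]

/-- The Laplace transform of the law of `X` weighted by `m(X, A)`: the exponential is absorbed by
a Cameron–Martin translation, to which `m` responds by the factor `exp ⟨Y(t), ξ⟩`. -/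
lemma IsChaosVersion.lintegral_exp_mul [IsProbabilityMeasure P] (hX : IsStandardGaussian X)
    (hm : IsChaosVersion e X Y m) {A : Set T} (hA : MeasurableSet A) (F : Finset ι) (c : F → ℝ) :
    ∫⁻ ω, ENNReal.ofReal (Real.exp (∑ i : F, c i * X.value e ω i)) * m (X.value e ω) A ∂P =
      ENNReal.ofReal (Real.exp (‖∑ i : F, c i • e i‖ ^ 2 / 2)) *
        ∫⁻ t in A, ENNReal.ofReal (Real.exp (∑ i : F, c i * Y.value e t i)) ∂μ := by
  set ξ : H := ∑ i : F, c i • e i with hξ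
  have hXm := X.measurable_value e
  have hXp := X.measurable_pairing ξ
  have hYp := Y.measurable_pairing ξ
  have hmA := hm.measurable_apply e hA
  have hY : ∫⁻ t in A, ENNReal.ofReal (Real.exp (∑ i : F, c i * Y.value e t i)) ∂μ =
      ∫⁻ t in A, ENNReal.ofReal (Real.exp (Y.pairing ξ t)) ∂μ := by
    refine lintegral_congr_ae (ae_restrict_of_ae ?_)
    filter_upwards [Y.pairing_sum e F c] with t ht
    rw [ht]
  have hshift : ∫⁻ ω, m (X.value e ω + coords e ξ) A ∂P =
      ∫⁻ t in A, ENNReal.ofReal (Real.exp (Y.pairing ξ t)) ∂μ := by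
    have hbind : ∫⁻ t in A, ENNReal.ofReal (Real.exp (Y.pairing ξ t)) ∂μ =
        ∫⁻ ω, ∫⁻ t in A, ENNReal.ofReal (Real.exp (Y.pairing ξ t)) ∂(m (X.value e ω)) ∂P := by
      have hg : Measurable (A.indicator fun t => ENNReal.ofReal (Real.exp (Y.pairing ξ t))) :=
        Measurable.indicator (by fun_prop) hA
      have h := Measure.lintegral_bind (m := P) (μ := fun ω => m (X.value e ω))
        (hm.measurable.comp hXm).aemeasurable hg.aemeasurable
      rw [hm.mean] at h
      simpa only [lintegral_indicator hA] using h
    rw [hbind]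
    refine lintegral_congr_ae ?_
    filter_upwards [hm.shift ξ] with ω hω
    rw [hω, withDensity_apply _ hA]
  have hCM : ∫⁻ ω, m (X.value e ω + coords e ξ) A ∂P =
      ∫⁻ ω, ENNReal.ofReal (Real.exp (X.pairing ξ ω - ‖ξ‖ ^ 2 / 2)) * m (X.value e ω) A ∂P := by
    have h1 := lintegral_map (μ := P) hmA (hXm.add_const (coords e ξ))
    rw [← h1, hX.map_value_add_coords e ξ, lintegral_map hmA hXm,
      lintegral_withDensity_eq_lintegral_mul _ (by fun_prop)
        (g := fun ω => m (X.value e ω) A) (hmA.comp hXm)]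
    rfl
  rw [hY, ← hshift, hCM, ← lintegral_const_mul' _ _ ENNReal.ofReal_ne_top]
  refine lintegral_congr_ae ?_
  filter_upwards [X.pairing_sum e F c] with ω hω
  rw [← mul_assoc, ← ENNReal.ofReal_mul (Real.exp_pos _).le, ← Real.exp_add, ← hω, ← hξ]
  ring_nf

lemma IsStandardGaussian.lintegral_exp_shifted [SFinite P] [SigmaFinite μ]
    (hX : IsStandardGaussian X) (A : Set T) (F : Finset ι) (c : F → ℝ) :
    ∫⁻ p, ENNReal.ofReal (Real.exp (∑ i : F, c i * shifted e X Y p i)) ∂(P.prod (μ.restrict A)) =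
      ENNReal.ofReal (Real.exp (‖∑ i : F, c i • e i‖ ^ 2 / 2)) *
        ∫⁻ t in A, ENNReal.ofReal (Real.exp (∑ i : F, c i * Y.value e t i)) ∂μ := by
  have hXm := X.measurable_value e
  have hYm := Y.measurable_value e
  rw [← hX.lintegral_exp_value e, ← lintegral_prod_mul (by fun_prop) (by fun_prop)]
  refine lintegral_congr fun p => ?_
  rw [← ENNReal.ofReal_mul (Real.exp_pos _).le, ← Real.exp_add, ← Finset.sum_add_distrib]
  simp only [shifted, Pi.add_apply, mul_add]

lemma measurable_shifted : Measurable (shifted e X Y) :=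
  ((X.measurable_value e).comp measurable_fst).add ((Y.measurable_value e).comp measurable_snd)

lemma map_shifted_restrict_apply [SFinite P] [SigmaFinite μ] {B : Set (ι → ℝ)}
    (hB : MeasurableSet B) (A : Set T) :
    (P.prod (μ.restrict A)).map (shifted e X Y) B =
      (P.prod μ) (shifted e X Y ⁻¹' B ∩ Prod.snd ⁻¹' A) := by
  have hprod : P.prod (μ.restrict A) = (P.prod μ).restrict (Prod.snd ⁻¹' A) := by
    have := Measure.prod_restrict (μ := P) (ν := μ) Set.univ A
    rwa [Measure.restrict_univ, Set.univ_prod] at this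
  rw [Measure.map_apply (measurable_shifted e) hB, hprod,
    Measure.restrict_apply (measurable_shifted e hB)]

/-- The law of `X` weighted by `m(X, A)` and the law of `X + Y(t)` for `t` sampled in `A` have the
same finite-dimensional marginals, provided that the coordinates of `Y` involved are bounded
on `A`, which makes the Laplace transforms finite. -/
lemma IsChaosVersion.map_restrict_eq_of_bounded [IsProbabilityMeasure P] [SigmaFinite μ]
    (hX : IsStandardGaussian X) (hm : IsChaosVersion e X Y m) {A : Set T} (hA : MeasurableSet A)
    (hAfin : μ A ≠ ∞) (F : Finset ι) {C : ℝ} (hC : ∀ t ∈ A, ∀ i ∈ F, |Y.value e t i| ≤ C) :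
    ((law e X).withDensity fun x => m x A).map F.restrict =
      ((P.prod (μ.restrict A)).map (shifted e X Y)).map F.restrict := by
  have hXm := X.measurable_value e
  have hmA := hm.measurable_apply e hA
  have : IsFiniteMeasure (μ.restrict A) := ⟨by simpa using hAfin.lt_top⟩
  have : IsFiniteMeasure ((law e X).withDensity fun x => m x A) := by
    refine isFiniteMeasure_withDensity ?_
    rwa [law, lintegral_map hmA hXm, hm.lintegral_apply e hA]
  have hleft : ∀ c : F → ℝ, ∫⁻ x, ENNReal.ofReal (Real.exp (∑ i : F, c i * x i))
      ∂((law e X).withDensity fun x => m x A) =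
      ENNReal.ofReal (Real.exp (‖∑ i : F, c i • e i‖ ^ 2 / 2)) *
        ∫⁻ t in A, ENNReal.ofReal (Real.exp (∑ i : F, c i * Y.value e t i)) ∂μ := by
    intro c
    rw [lintegral_withDensity_eq_lintegral_mul _ hmA (by fun_prop), law,
      lintegral_map (hmA.mul (by fun_prop)) hXm, ← hm.lintegral_exp_mul e hX hA]
    exact lintegral_congr fun ω => mul_comm _ _
  refine map_restrict_eq_of_lintegral_exp_eq F (fun c => ?_) fun c => ?_
  · rw [hleft]
    refine ENNReal.mul_ne_top ENNReal.ofReal_ne_top (ne_top_of_le_ne_top ?_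
      (setLIntegral_mono_ae (g := fun _ => ENNReal.ofReal (Real.exp (∑ i : F, |c i| * C)))
        aemeasurable_const (ae_of_all _ fun t ht => ?_)))
    · rw [setLIntegral_const]
      exact ENNReal.mul_ne_top ENNReal.ofReal_ne_top hAfin
    · refine ENNReal.ofReal_le_ofReal (Real.exp_le_exp.2 (Finset.sum_le_sum fun i _ => ?_))
      refine (le_abs_self _).trans ?_
      rw [abs_mul]
      exact mul_le_mul_of_nonneg_left (hC t ht i i.2) (abs_nonneg _)
  · rw [hleft, lintegral_map (by fun_prop) (measurable_shifted e), hX.lintegral_exp_shifted e]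

/-- The randomized Cameron–Martin formula: sampling `t` from `m(X, ·)` shifts `X` by `Y(t)`. -/
lemma IsChaosVersion.setLIntegral_law [IsProbabilityMeasure P] [SigmaFinite μ]
    (hX : IsStandardGaussian X) (hm : IsChaosVersion e X Y m) {B : Set (ι → ℝ)}
    (hB : MeasurableSet B) {A : Set T} (hA : MeasurableSet A) :
    ∫⁻ x in B, m x A ∂(law e X) = (P.prod μ) (shifted e X Y ⁻¹' B ∩ Prod.snd ⁻¹' A) := by
  have hXm := X.measurable_value e
  have hYm := Y.measurable_value e
  -- Both sides are measures as functions of `A` for fixed `B`, so that they agree once they agree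
  -- on the measurable subsets of the members of a countable cover.
  have hcover : ∀ {B : Set (ι → ℝ)}, MeasurableSet B → ∀ s : ℕ → Set T,
      (∀ n, MeasurableSet (s n)) → ⋃ n, s n = Set.univ →
      (∀ n A, MeasurableSet A → A ⊆ s n → ∫⁻ x in B, m x A ∂(law e X) =
        (P.prod μ) (shifted e X Y ⁻¹' B ∩ Prod.snd ⁻¹' A)) →
      ∀ A, MeasurableSet A → ∫⁻ x in B, m x A ∂(law e X) =
        (P.prod μ) (shifted e X Y ⁻¹' B ∩ Prod.snd ⁻¹' A) := by
    intro B hB s hs hsU hsub A hA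
    have hbind : ∀ A, MeasurableSet A →
        ((law e X).restrict B).bind m A = ∫⁻ x in B, m x A ∂(law e X) := fun A hA =>
      Measure.bind_apply hA hm.measurable.aemeasurable
    have hsnd : ∀ A, MeasurableSet A →
        (((P.prod μ).restrict (shifted e X Y ⁻¹' B)).map Prod.snd) A =
          (P.prod μ) (shifted e X Y ⁻¹' B ∩ Prod.snd ⁻¹' A) := fun A hA => by
      rw [Measure.map_apply measurable_snd hA, Measure.restrict_apply (measurable_snd hA),
        Set.inter_comm]
    rw [← hbind A hA, ← hsnd A hA]
    congr 1
    refine (Measure.ext_iff_of_iUnion_eq_univ hsU).2 fun n => Measure.ext fun A' hA' => ?_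
    have hA'n := hA'.inter (hs n)
    rw [Measure.restrict_apply hA', Measure.restrict_apply hA', hbind _ hA'n, hsnd _ hA'n]
    exact hsub n _ hA'n Set.inter_subset_right
  -- First for cylinders `B`, covering `T` by sets on which the relevant coordinates are bounded.
  have hcyl : ∀ (F : Finset ι) (D : Set (F → ℝ)), MeasurableSet D → ∀ A, MeasurableSet A →
      ∫⁻ x in F.restrict ⁻¹' D, m x A ∂(law e X) =
        (P.prod μ) (shifted e X Y ⁻¹' (F.restrict ⁻¹' D) ∩ Prod.snd ⁻¹' A) := by
    intro F D hD
    have hFD : MeasurableSet (F.restrict (π := fun _ => ℝ) ⁻¹' D) :=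
      Finset.measurable_restrict F hD
    let s : ℕ → Set T := fun n =>
      spanningSets μ n ∩ {t | ∑ i : F, |Y.value e t i| ≤ n}
    have hs : ∀ n, MeasurableSet (s n) := fun n => (measurableSet_spanningSets μ n).inter
      (measurableSet_le (by fun_prop) measurable_const)
    refine hcover hFD s hs (Set.eq_univ_of_forall fun t => Set.mem_iUnion.2 ?_) ?_
    · obtain ⟨k, hk⟩ := exists_nat_ge (∑ i : F, |Y.value e t i|)
      refine ⟨max (spanningSetsIndex μ t) k, ?_, hk.trans (by exact_mod_cast le_max_right _ _)⟩
      exact monotone_spanningSets μ (le_max_left _ _) (mem_spanningSetsIndex μ t)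
    · intro n A hA hAs
      have hAfin : μ A ≠ ∞ := ((measure_mono (hAs.trans Set.inter_subset_left)).trans_lt
        (measure_spanningSets_lt_top μ n)).ne
      have hmap := hm.map_restrict_eq_of_bounded e hX hA hAfin F (C := n) fun t ht i hi =>
        (Finset.single_le_sum (f := fun j : F => |Y.value e t j|) (fun j _ => abs_nonneg _)
          (Finset.mem_univ ⟨i, hi⟩)).trans (hAs ht).2
      have hF : Measurable (F.restrict (π := fun _ => ℝ)) := Finset.measurable_restrict F
      have hD' := congrArg (fun ρ => ρ D) hmap
      simp only [Measure.map_apply hF hD] at hD'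
      rwa [withDensity_apply _ hFD, map_shifted_restrict_apply e hFD A] at hD'
  -- Then for all `B`, covering `T` by sets of finite measure.
  refine hcover hB (spanningSets μ) (measurableSet_spanningSets μ) (iUnion_spanningSets μ) ?_ A hA
  intro n A hA hAn
  have hAfin : μ A ≠ ∞ := ((measure_mono hAn).trans_lt (measure_spanningSets_lt_top μ n)).ne
  have hfin : IsFiniteMeasure ((law e X).withDensity fun x => m x A) := by
    refine isFiniteMeasure_withDensity ?_
    rwa [law, lintegral_map (hm.measurable_apply e hA) hXm, hm.lintegral_apply e hA]
  have heq : ((law e X).withDensity fun x => m x A) =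
      (P.prod (μ.restrict A)).map (shifted e X Y) := by
    refine ext_of_map_restrict fun F => Measure.ext fun D hD => ?_
    have hFD : MeasurableSet (F.restrict (π := fun _ => ℝ) ⁻¹' D) :=
      Finset.measurable_restrict F hD
    have hF : Measurable (F.restrict (π := fun _ => ℝ)) := Finset.measurable_restrict F
    rw [Measure.map_apply hF hD, Measure.map_apply hF hD, withDensity_apply _ hFD,
      map_shifted_restrict_apply e hFD A]
    exact hcyl F D hD A hA
  rw [← withDensity_apply _ hB, heq, map_shifted_restrict_apply e hB A]

end

/-! ### Density of the shifted law and conditional law -/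

section

variable {H : Type*} [NormedAddCommGroup H] [InnerProductSpace ℝ H] {ι : Type*}
  (e : HilbertBasis ι ℝ H)

variable {Ω T : Type*} [MeasurableSpace Ω] [MeasurableSpace T] {P : Measure Ω}
  {μ : Measure T} {X : GeneralizedFunction H P} {Y : GeneralizedFunction H μ}
  {M : Ω → Measure T} {m : (ι → ℝ) → Measure T}

lemma IsFunctionalOf.measurable_apply (hm : IsFunctionalOf e X M m) {A : Set T}
    (hA : MeasurableSet A) : Measurable fun x => m x A :=
  (Measure.measurable_coe hA).comp hm.measurable

/-- The randomized Cameron–Martin formula for an arbitrary version `m` of `M` as a function of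
`X`, which need not itself satisfy the shift covariance. -/
lemma IsGMC.setLIntegral_law [IsProbabilityMeasure P] [SigmaFinite μ]
    (hX : IsStandardGaussian X) (hM : IsGMC e X Y M) (hMμ : expectation P M = μ)
    (hm : IsFunctionalOf e X M m) {B : Set (ι → ℝ)} (hB : MeasurableSet B) {A : Set T}
    (hA : MeasurableSet A) :
    ∫⁻ x in B, m x A ∂(law e X) = (P.prod μ) (shifted e X Y ⁻¹' B ∩ Prod.snd ⁻¹' A) := by
  obtain ⟨m₀, hm₀, hshift⟩ := hM.shift
  have hchaos : IsChaosVersion e X Y m₀ :=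
    ⟨hm₀.measurable, (Measure.bind_congr_right hm₀.eq).symm.trans hMμ, hshift⟩
  have hpull : ∀ m : (ι → ℝ) → Measure T, IsFunctionalOf e X M m →
      ∫⁻ x in B, m x A ∂(law e X) = ∫⁻ ω in X.value e ⁻¹' B, M ω A ∂P := by
    intro m hm
    rw [law, setLIntegral_map hB (hm.measurable_apply e hA) (X.measurable_value e)]
    refine lintegral_congr_ae (ae_restrict_of_ae ?_)
    filter_upwards [hm.eq] with ω hω
    rw [hω]
  rw [hpull m hm, ← hpull m₀ hm₀, hchaos.setLIntegral_law e hX hB hA]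

lemma IsFunctionalOf.ae_isFiniteMeasure (hm : IsFunctionalOf e X M m)
    (hfin : ∀ᵐ ω ∂P, IsFiniteMeasure (M ω)) : ∀ᵐ x ∂(law e X), IsFiniteMeasure (m x) := by
  have hae : ∀ᵐ x ∂(law e X), m x Set.univ < ∞ := by
    rw [law, ae_map_iff (X.measurable_value e).aemeasurable
      (measurableSet_lt (hm.measurable_apply e MeasurableSet.univ) measurable_const)]
    filter_upwards [hm.eq, hfin] with ω h1 h2
    rw [← h1]
    exact measure_lt_top _ _
  filter_upwards [hae] with x hx
  exact ⟨hx⟩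

lemma IsGMC.lawShifted_eq_withDensity [IsProbabilityMeasure P] [SigmaFinite μ]
    (hX : IsStandardGaussian X) (hM : IsGMC e X Y M) (hMμ : expectation P M = μ)
    (hm : IsFunctionalOf e X M m) :
    lawShifted e X Y = (law e X).withDensity fun x => m x Set.univ := by
  refine Measure.ext fun B hB => ?_
  rw [withDensity_apply _ hB, hM.setLIntegral_law e hX hMμ hm hB MeasurableSet.univ, lawShifted,
    Measure.map_apply (measurable_shifted e) hB, Set.preimage_univ, Set.inter_univ]

/-- By the randomized Cameron–Martin formula, the law of `X + Y(t)` has the total mass of `m` as its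
density, so that normalizing `m` disintegrates the joint law. -/
lemma IsGMC.isCondLaw [IsProbabilityMeasure P] [SigmaFinite μ]
    (hX : IsStandardGaussian X) (hM : IsGMC e X Y M) (hMμ : expectation P M = μ)
    (hm : IsFunctionalOf e X M m) :
    IsCondLaw (P.prod μ) Prod.snd (shifted e X Y) (fun x => (m x Set.univ)⁻¹ • m x) := by
  have hmass := hm.measurable_apply e MeasurableSet.univ
  have hfin := hm.ae_isFiniteMeasure e hM.isRandomMeasure.finite
  have hlaw := hM.lawShifted_eq_withDensity e hX hMμ hm
  rw [lawShifted] at hlaw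
  refine ⟨Measure.measurable_of_measurable_coe _ fun A hA => ?_, ?_, fun B hB A hA => ?_⟩
  · simp only [Measure.smul_apply, smul_eq_mul]
    exact hmass.inv.mul (hm.measurable_apply e hA)
  · rw [hlaw, ae_withDensity_iff hmass]
    filter_upwards [hfin] with x hx hx0
    refine ⟨?_⟩
    rw [Measure.smul_apply, smul_eq_mul, ENNReal.inv_mul_cancel hx0 (measure_ne_top _ _)]
  · have hmA := hm.measurable_apply e hA
    rw [← hM.setLIntegral_law e hX hMμ hm hB hA, hlaw]
    simp only [Measure.smul_apply, smul_eq_mul]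
    rw [setLIntegral_withDensity_eq_setLIntegral_mul _ hmass
      (g := fun x => (m x Set.univ)⁻¹ * m x A) (hmass.inv.mul hmA) hB]
    refine lintegral_congr_ae (ae_restrict_of_ae ?_)
    filter_upwards [hfin] with x hx
    rw [Pi.mul_apply, ← mul_assoc]
    by_cases h0 : m x Set.univ = 0
    -- Where the total mass vanishes, so does `m x A`, and the junk value of `0⁻¹` is harmless.
    · simp [h0, measure_mono_null (Set.subset_univ A) h0]
    · rw [ENNReal.mul_inv_cancel h0 (measure_ne_top _ _), one_mul]

end

/-- Regular conditional laws are unique almost everywhere, also for σ-finite laws. -/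
lemma IsCondLaw.ae_eq {S E T : Type*} [MeasurableSpace S] [MeasurableSpace E] [MeasurableSpace T]
    [MeasurableSpace.CountablyGenerated T] {ρ : Measure S} {V : S → T} {U : S → E}
    [SigmaFinite (ρ.map U)] {κ κ' : E → Measure T} (hκ : IsCondLaw ρ V U κ)
    (hκ' : IsCondLaw ρ V U κ') : ∀ᵐ x ∂(ρ.map U), κ x = κ' x := by
  refine ae_eq_of_forall_measure_ae_eq ?_ fun A hA => ?_
  · filter_upwards [hκ.isProbabilityMeasure] with x hx
    infer_instance
  · refine ae_eq_of_forall_setLIntegral_eq_of_sigmaFinite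
      (f := fun x => κ x A) (g := fun x => κ' x A) ((Measure.measurable_coe hA).comp hκ.measurable)
      ((Measure.measurable_coe hA).comp hκ'.measurable) fun B hB _ => ?_
    rw [← hκ.disintegrate B hB A hA, ← hκ'.disintegrate B hB A hA]

end GMC

theorem mainTheorem3
    {H : Type*} [NormedAddCommGroup H] [InnerProductSpace ℝ H] [CompleteSpace H]
    [TopologicalSpace.SeparableSpace H]
    {ι : Type*} [Countable ι] (e : HilbertBasis ι ℝ H)
    {Ω : Type*} [MeasurableSpace Ω] [StandardBorelSpace Ω] (P : Measure Ω) [IsProbabilityMeasure P]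
    {T : Type*} [MeasurableSpace T] [StandardBorelSpace T] (μ : Measure T) [SigmaFinite μ]
    (X : GMC.GeneralizedFunction H P) (hX : GMC.IsStandardGaussian X)
    (Y : GMC.GeneralizedFunction H μ)
    (M : Ω → Measure T) (hM : GMC.IsSubcriticalGMC e X Y M) (hMμ : GMC.expectation P M = μ) :
    -- uniqueness as a function of `X`
    (∀ M' : Ω → Measure T, GMC.IsSubcriticalGMC e X Y M' → GMC.expectation P M' = μ →
      ∀ᵐ ω ∂P, M' ω = M ω) ∧
    -- the total mass is the Radon-Nikodym density of the law of `X + Y(t)`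
    (GMC.lawShifted e X Y ≪ GMC.law e X ∧
      ∀ᵐ ω ∂P, M ω Set.univ =
        (GMC.lawShifted e X Y).rnDeriv (GMC.law e X) (X.value e ω)) ∧
    -- the normalized measure is the conditional law of `t` given `X + Y(t)`
    (∀ m : (ι → ℝ) → Measure T, GMC.IsFunctionalOf e X M m →
      GMC.IsCondLaw (P.prod μ) Prod.snd (GMC.shifted e X Y)
        (fun x => (m x Set.univ)⁻¹ • m x) ∧
      ∀ κ : (ι → ℝ) → Measure T,
        GMC.IsCondLaw (P.prod μ) Prod.snd (GMC.shifted e X Y) κ →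
        ∀ᵐ x ∂(GMC.lawShifted e X Y), (m x Set.univ)⁻¹ • m x = κ x) := by
  have hXm := X.measurable_value e
  have hlaw : IsProbabilityMeasure (GMC.law e X) :=
    Measure.isProbabilityMeasure_map hXm.aemeasurable
  obtain ⟨m₀, hm₀, -⟩ := hM.isGMC.shift
  have hdens := hM.isGMC.lawShifted_eq_withDensity e hX hMμ hm₀
  have hmass := hm₀.measurable_apply e MeasurableSet.univ
  refine ⟨fun M' hM' hM'μ => ?_, ⟨?_, ?_⟩, fun m hm => ⟨hM.isGMC.isCondLaw e hX hMμ hm, ?_⟩⟩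
  · obtain ⟨m', hm', -⟩ := hM'.isGMC.shift
    refine GMC.ae_eq_of_forall_measure_ae_eq hM'.isGMC.isRandomMeasure.finite fun A hA => ?_
    have hae : ∀ᵐ x ∂(GMC.law e X), m' x A = m₀ x A := by
      refine ae_eq_of_forall_setLIntegral_eq_of_sigmaFinite
        (hm'.measurable_apply e hA) (hm₀.measurable_apply e hA) fun B hB _ => ?_
      rw [hM'.isGMC.setLIntegral_law e hX hM'μ hm' hB hA,
        hM.isGMC.setLIntegral_law e hX hMμ hm₀ hB hA]
    filter_upwards [ae_of_ae_map hXm.aemeasurable hae, hm'.eq, hm₀.eq] with ω h1 h2 h3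
    rw [h2, h3, h1]
  · rw [hdens]
    exact withDensity_absolutelyContinuous _ _
  · have hrn := Measure.rnDeriv_withDensity (GMC.law e X) hmass
    rw [← hdens] at hrn
    filter_upwards [ae_of_ae_map hXm.aemeasurable hrn, hm₀.eq] with ω h1 h2
    rw [h1, h2]
  · intro κ hκ
    have hσ : SigmaFinite ((P.prod μ).map (GMC.shifted e X Y)) := by
      change SigmaFinite (GMC.lawShifted e X Y)
      rw [hdens]
      refine SigmaFinite.withDensity_of_ne_top ?_
      filter_upwards [hm₀.ae_isFiniteMeasure e hM.isGMC.isRandomMeasure.finite] with x hx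
      exact measure_ne_top _ _
    exact (hM.isGMC.isCondLaw e hX hMμ hm).ae_eq hκ
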